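/- Let $L,M,N,r_{\Sigma}$ be integers with $L\ge 1$, $M,r_\Sigma\ge 0$ and $r_{\Sigma}<N$, and let $p_1,\dots,p_L\ge 0$ with $\sum_i p_i=1$. Let $\Sigma_1,\dots,\Sigma_L\in\mathbb{R}^{N\times N}$ be random symmetric positive semidefinite matrices whose images $\mathcal{R}_i=\mathrm{Im}(\Sigma_i)$ have dimension $r_{\Sigma}$ and are independent random points of the Grassmann manifold of $r_\Sigma$-dimensional subspaces of $\mathbb{R}^N$, each having a probability density with respect to the uniform (rotation-invariant) measure. Let $\Phi\in\mathbb{R}^{M\times N}$ be a random matrix, independent of $(\mathcal{R}_1,\dots,\mathcal{R}_L)$, with a left rotation-invariant distribution, that is, its entries have a joint pdf $f$ with respect to Lebesgue measure such that $f(\Theta A)=f(A)$ (for almost every $A$) for every orthogonal $\Theta\in\mathbb{R}^{M\times M}$. Given $\Phi$ and $(\Sigma_i)_i$, consider the measurement $y=\Phi x+n$, where the class $C\in\{1,\dots,L\}$ satisfies $\mathbb{P}[C=i]=p_i$, the signal $x$ given $C=i$ is distributed as $\mathcal{N}(0,\Sigma_i)$, and the noise $n\sim\mathcal{N}(0,\sigma^2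 I)$ is independent of $(C,x)$. Let $P_e=\mathbb{P}[\hat C(y)\neq C]=\sum_i p_i\,\mathbb{P}[\hat C(y)\ne i\mid C=i]$ be the misclassification probability, for these $\Phi$ and $(\Sigma_i)_i$, of a maximum a posteriori classifier $\hat C(y)\in\arg\max_i p(y\mid C=i)\,p_i$ (ties broken in any measurable way), where $p(y\mid C=i)$ is the conditional pdf of $y$. Then: 1. almost surely, $\mathrm{rank}(\Phi\Sigma_i\Phi^T)=\min\{M,r_\Sigma\}$ for all $i$, and $\mathrm{rank}(\Phi(\Sigma_i+\Sigma_j)\Phi^T)=\min\{M,N,2r_\Sigma\}$ for all $i\ne j$; 2. if $r_\Sigma\ge 1$ and $M\ge r_\Sigma+1$, then almost surely $\lim_{\sigma^2\to 0}P_e=0$. In particular, $M=r_\Sigma+1$ measurements suffice, so that $r_\Sigma+1$ is an upper bound on the minimum number of measurements for which $\lim_{\sigma^2\to0}P_e=0$. -/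

import Mathlib

open MeasureTheory ProbabilityTheory Filter Topology
open scoped ENNReal

noncomputable section

namespace LowNoise

/-- Linearly independent `r`-tuples of vectors (`r`-frames) in `ℝ^N`. -/
abbrev Frame (N r : ℕ) : Type :=
  {v : Fin r → EuclideanSpace ℝ (Fin N) // LinearIndependent ℝ v}

/-- The Grassmann manifold of `r`-dimensional linear subspaces of `ℝ^N`. -/
def Grassmann (N r : ℕ) : Type :=
  {V : Submodule ℝ (EuclideanSpace ℝ (Fin N)) // Module.finrank ℝ V = r}

/-- The underlying linear subspace of a point of the Grassmann manifold. -/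
def Grassmann.toSubmodule {N r : ℕ} (V : Grassmann N r) :
    Submodule ℝ (EuclideanSpace ℝ (Fin N)) := V.1

/-- The subspace spanned by a frame. -/
def Frame.span {N r : ℕ} (v : Frame N r) : Grassmann N r :=
  ⟨Submodule.span ℝ (Set.range v.1), by
    simpa using finrank_span_eq_card v.2⟩

/-- The topology of the Grassmann manifold: the quotient topology of the space of frames. -/
instance (N r : ℕ) : TopologicalSpace (Grassmann N r) :=
  TopologicalSpace.coinduced Frame.span inferInstance

/-- The Borel σ-algebra of the Grassmann manifold. -/
instance (N r : ℕ) : MeasurableSpace (Grassmann N r) := borel _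

instance (N r : ℕ) : BorelSpace (Grassmann N r) := ⟨rfl⟩

/-- The uniform (rotation-invariant) probability measure on the Grassmann manifold (`r ≤ N`):
the law of the span of `r` independent standard Gaussian vectors of `ℝ^N`. Such vectors are almost
surely linearly independent, so restricting to frames loses no mass. -/
def Grassmann.uniform (N r : ℕ) : Measure (Grassmann N r) :=
  ((Measure.pi fun _ : Fin r => stdGaussian (EuclideanSpace ℝ (Fin N))).comap
    (Subtype.val : Frame N r → Fin r → EuclideanSpace ℝ (Fin N))).map Frame.span

/-- A distribution on the Grassmann manifold is continuous if it has a probability density function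
with respect to the uniform measure. -/
def Grassmann.HasDensity {N r : ℕ} (μ : Measure (Grassmann N r)) : Prop :=
  ∃ f : Grassmann N r → ℝ≥0∞, Measurable f ∧ μ = (Grassmann.uniform N r).withDensity f

/-- The distribution `μ` of (the entries of) a random `M × N` matrix is left rotation-invariant:
the entries have a joint pdf `p` with respect to Lebesgue measure, and `p (Θ A) = p A` for every
orthogonal `Θ`. (A pdf being determined almost everywhere only, the identity is required for almost
every `A`.) -/
def IsLeftRotationInvariant {M N : ℕ} (μ : Measure (Fin M → Fin N → ℝ)) : Prop :=
  ∃ p : (Fin M → Fin N → ℝ) → ℝ≥0∞, Measurable p ∧ μ = volume.withDensity p ∧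
    ∀ Θ ∈ Matrix.orthogonalGroup (Fin M) ℝ, ∀ᵐ A : Fin M → Fin N → ℝ,
      p (Θ * Matrix.of A : Matrix (Fin M) (Fin N) ℝ) = p A

/-- The conditional law of the measurement `y = Φ x + n` given the class, where
`x ∼ 𝒩(0, S)` and `n ∼ 𝒩(0, s I)` are independent; `s` is the noise variance `σ²`. -/
def measurementLaw {M N : ℕ} (Φ : Matrix (Fin M) (Fin N) ℝ) (S : Matrix (Fin N) (Fin N) ℝ)
    (s : ℝ) : Measure (EuclideanSpace ℝ (Fin M)) :=
  ((multivariateGaussian 0 S).prod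
      (multivariateGaussian 0 (s • (1 : Matrix (Fin M) (Fin M) ℝ)))).map
    fun q => Φ.toEuclideanLin q.1 + q.2

/-- The conditional pdf `p(y | C = i)` of the measurement. -/
def measurementPDF {M N : ℕ} (Φ : Matrix (Fin M) (Fin N) ℝ) (S : Matrix (Fin N) (Fin N) ℝ)
    (s : ℝ) : EuclideanSpace ℝ (Fin M) → ℝ≥0∞ :=
  (measurementLaw Φ S s).rnDeriv volume

/-- `c` is a maximum a posteriori classifier: a measurable map with
`c y ∈ argmax_i p(y | C = i) p_i` for (almost) every `y`, ties being broken arbitrarily. -/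
structure IsMAPClassifier {M N L : ℕ} (p : Fin L → ℝ) (Φ : Matrix (Fin M) (Fin N) ℝ)
    (S : Fin L → Matrix (Fin N) (Fin N) ℝ) (s : ℝ) (c : EuclideanSpace ℝ (Fin M) → Fin L) :
    Prop where
  measurable : Measurable c
  isArgmax : ∀ᵐ y, ∀ j, measurementPDF Φ (S j) s y * ENNReal.ofReal (p j) ≤
    measurementPDF Φ (S (c y)) s y * ENNReal.ofReal (p (c y))

/-- The misclassification probability `P[c(y) ≠ C] = ∑_i p_i P[c(y) ≠ i | C = i]`
of a classifier `c`. -/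
def errorProb {M N L : ℕ} (p : Fin L → ℝ) (Φ : Matrix (Fin M) (Fin N) ℝ)
    (S : Fin L → Matrix (Fin N) (Fin N) ℝ) (s : ℝ) (c : EuclideanSpace ℝ (Fin M) → Fin L) : ℝ :=
  ∑ i, p i * (measurementLaw Φ (S i) s).real {y | c y ≠ i}

end LowNoise

end

/-!
A positive semidefinite `S` satisfies `rank (Φ S Φᵀ) = dim (Φ (Im S))`, and `S + T` has image
`Im S + Im T`, so all the ranks are dimensions of images under `Φ` of sums of subspaces.
Conditioning on everything but one factor reduces their generic values to two facts: Gaussian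
vectors avoid any given proper subspace, so a random subspace is in general position with respect to
a fixed one, and a matrix with absolutely continuous law has maximal rank on a fixed subspace.

If `rank (Φ Sᵢ Φᵀ) < rank (Φ (Sᵢ + Sⱼ) Φᵀ)`, then `Φ (Im Sⱼ)` is not contained in `U = Φ (Im Sᵢ)`.
The noiseless measurement lies in `U` for class `i`, and almost surely off `U` for class `j`. As the
noise has size `√s`, the test `y ∈ thickening (√√s) U` distinguishes `i` from `j` with vanishing
error, and a maximum a posteriori classifier confuses the two classes no more than any test does.
-/

namespace LowNoise

section Matrices

open scoped ComplexOrder MatrixOrder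

variable {𝕜 l m n : Type*} [RCLike 𝕜] [Fintype m] [Fintype n]

theorem rank_mul_mul_conjTranspose (A : Matrix m n 𝕜) {S : Matrix n n 𝕜} (hS : S.PosSemidef) :
    (A * S * A.conjTranspose).rank = (A * S).rank := by
  have hker : (A * S * A.conjTranspose).mulVecLin.ker = (S * A.conjTranspose).mulVecLin.ker := by
    refine le_antisymm (fun v hv => ?_) fun v hv => ?_
    · simp only [LinearMap.mem_ker, Matrix.mulVecLin_apply, Matrix.mul_assoc,
        ← Matrix.mulVec_mulVec] at hv ⊢
      rw [← hS.dotProduct_mulVec_zero_iff, Matrix.star_mulVec, Matrix.conjTranspose_conjTranspose,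
        ← Matrix.dotProduct_mulVec, hv, dotProduct_zero]
    · simp only [LinearMap.mem_ker, Matrix.mulVecLin_apply, Matrix.mul_assoc] at hv ⊢
      rw [← Matrix.mulVec_mulVec, hv, Matrix.mulVec_zero]
  have hrank : (A * S * A.conjTranspose).rank = (S * A.conjTranspose).rank := by
    have h₁ := LinearMap.finrank_range_add_finrank_ker (A * S * A.conjTranspose).mulVecLin
    have h₂ := LinearMap.finrank_range_add_finrank_ker (S * A.conjTranspose).mulVecLin
    rw [hker] at h₁
    exact add_right_cancel (h₁.trans h₂.symm)
  rw [hrank, ← Matrix.rank_conjTranspose (A * S), Matrix.conjTranspose_mul, hS.isHermitian.eq]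

variable [DecidableEq n]

theorem finrank_range_toEuclideanLin [Finite l] (A : Matrix l n 𝕜) :
    Module.finrank 𝕜 (LinearMap.range A.toEuclideanLin) = A.rank := by
  rw [Matrix.toEuclideanLin, Matrix.toLpLin_eq_toLin]
  exact (A.rank_eq_finrank_range_toLin _ _).symm

theorem finrank_map_range_toEuclideanLin [Finite l] [DecidableEq m] (A : Matrix l m 𝕜)
    (B : Matrix m n 𝕜) :
    Module.finrank 𝕜 ((LinearMap.range B.toEuclideanLin).map A.toEuclideanLin) = (A * B).rank := by
  rw [← LinearMap.range_comp, ← finrank_range_toEuclideanLin (A * B)]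
  exact congrArg (fun f => Module.finrank 𝕜 (LinearMap.range f))
    (Matrix.toLpLin_mul_same 2 A B).symm

theorem ker_toEuclideanLin_add {S T : Matrix n n 𝕜} (hS : S.PosSemidef) (hT : T.PosSemidef) :
    LinearMap.ker (S + T).toEuclideanLin =
      LinearMap.ker S.toEuclideanLin ⊓ LinearMap.ker T.toEuclideanLin := by
  ext x
  have hmem (A : Matrix n n 𝕜) : x ∈ LinearMap.ker A.toEuclideanLin ↔ A.mulVec x.ofLp = 0 := by
    simp [Matrix.toLpLin_apply]
  simp only [Submodule.mem_inf, hmem]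
  refine ⟨fun h => ?_, fun h => by rw [Matrix.add_mulVec, h.1, h.2, add_zero]⟩
  have hsum : star x.ofLp ⬝ᵥ S.mulVec x.ofLp + star x.ofLp ⬝ᵥ T.mulVec x.ofLp = 0 := by
    rw [← dotProduct_add, ← Matrix.add_mulVec, h, dotProduct_zero]
  rwa [add_eq_zero_iff_of_nonneg (hS.dotProduct_mulVec_nonneg _) (hT.dotProduct_mulVec_nonneg _),
    hS.dotProduct_mulVec_zero_iff, hT.dotProduct_mulVec_zero_iff] at hsum

theorem range_toEuclideanLin_add {S T : Matrix n n 𝕜} (hS : S.PosSemidef) (hT : T.PosSemidef) :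
    LinearMap.range (S + T).toEuclideanLin =
      LinearMap.range S.toEuclideanLin ⊔ LinearMap.range T.toEuclideanLin := by
  have hsymm {A : Matrix n n 𝕜} (hA : A.PosSemidef) : A.toEuclideanLin.IsSymmetric :=
    Matrix.isSymmetric_toEuclideanLin_iff.2 hA.isHermitian
  rw [← Submodule.orthogonal_orthogonal (LinearMap.range _), (hsymm (hS.add hT)).orthogonal_range,
    ker_toEuclideanLin_add hS hT, ← (hsymm hS).orthogonal_range, ← (hsymm hT).orthogonal_range,
    Submodule.inf_orthogonal, Submodule.orthogonal_orthogonal]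

theorem range_toEuclideanLin_mul_self {A : Matrix n n 𝕜} (hA : A.IsHermitian) :
    LinearMap.range (A * A).toEuclideanLin = LinearMap.range A.toEuclideanLin := by
  refine Submodule.eq_of_le_of_finrank_eq ?_ ?_
  · rw [show (A * A).toEuclideanLin = _ from Matrix.toLpLin_mul_same 2 A A]
    exact LinearMap.range_comp_le_range _ _
  · rw [finrank_range_toEuclideanLin, finrank_range_toEuclideanLin]
    nth_rw 1 [← hA.eq]
    exact A.rank_conjTranspose_mul_self

theorem range_toEuclideanLin_sqrt {S : Matrix n n 𝕜} (hS : S.PosSemidef) :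
    LinearMap.range (CFC.sqrt S).toEuclideanLin = LinearMap.range S.toEuclideanLin := by
  rw [← range_toEuclideanLin_mul_self (CFC.sqrt_nonneg S).isSelfAdjoint.isHermitian,
    CFC.sqrt_mul_sqrt_self S hS.nonneg]

end Matrices

section GenericPosition

theorem lowerSemicontinuous_finrank_span {𝕜 F ι : Type*} [NontriviallyNormedField 𝕜]
    [CompleteSpace 𝕜] [NormedAddCommGroup F] [NormedSpace 𝕜 F] [Finite ι] :
    LowerSemicontinuous fun w : ι → F => Module.finrank 𝕜 (Submodule.span 𝕜 (Set.range w)) := by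
  refine lowerSemicontinuous_iff.2 fun w d hd => ?_
  obtain ⟨κ, a, ha, hspan, hli⟩ := exists_linearIndependent' 𝕜 w
  have := Finite.of_injective a ha
  have := Fintype.ofFinite κ
  have hrestrict : Continuous fun v : ι → F => v ∘ a :=
    continuous_pi fun i => continuous_apply (a i)
  filter_upwards [hrestrict.continuousAt.eventually
    (isOpen_setOfPred_linearIndependent.mem_nhds hli)] with v hv
  change d < _ at hd
  rw [← hspan, finrank_span_eq_card hli, ← finrank_span_eq_card hv] at hd
  have := FiniteDimensional.span_of_finite 𝕜 (Set.finite_range v)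
  exact hd.trans_le (Submodule.finrank_mono (Submodule.span_mono (Set.range_comp_subset_range a v)))

theorem measurable_finrank_span {𝕜 F ι : Type*} [NontriviallyNormedField 𝕜] [CompleteSpace 𝕜]
    [NormedAddCommGroup F] [NormedSpace 𝕜 F] [SecondCountableTopology F] [MeasurableSpace F]
    [BorelSpace F] [Finite ι] :
    Measurable fun w : ι → F => Module.finrank 𝕜 (Submodule.span 𝕜 (Set.range w)) :=
  lowerSemicontinuous_finrank_span.measurable

theorem measurable_rank {m n : Type*} [Finite m] [Fintype n] :
    Measurable fun A : m → n → ℝ => (Matrix.of A).rank := by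
  simp only [Matrix.rank_eq_finrank_span_row]
  exact measurable_finrank_span

theorem measurable_rank_mul {l m n : Type*} [Finite l] [Fintype m] [Fintype n] :
    Measurable fun q : (l → m → ℝ) × (m → n → ℝ) => (Matrix.of q.1 * Matrix.of q.2).rank := by
  refine measurable_rank.comp (f := fun q : (l → m → ℝ) × (m → n → ℝ) =>
    Matrix.of.symm (Matrix.of q.1 * Matrix.of q.2)) ?_
  refine measurable_pi_lambda _ fun a => measurable_pi_lambda _ fun b => ?_
  simp only [Matrix.of_symm_apply, Matrix.mul_apply, Matrix.of_apply]
  fun_prop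

theorem ae_pi_cons {E : Type*} [MeasurableSpace E] {μ : Measure E} [SigmaFinite μ] {k : ℕ}
    {p : (Fin (k + 1) → E) → Prop} (hp : MeasurableSet {v | p v})
    (h : ∀ᵐ w ∂Measure.pi fun _ : Fin k => μ, ∀ᵐ x ∂μ, p (Fin.cons x w)) :
    ∀ᵐ v ∂Measure.pi fun _ : Fin (k + 1) => μ, p v := by
  have hcons := (measurePreserving_piFinSuccAbove (fun _ : Fin (k + 1) => μ) 0).symm
  have hp' := hcons.measurable hp
  rw [← hcons.map_eq, ae_map_iff hcons.measurable.aemeasurable hp]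
  refine (Measure.ae_prod_iff_ae_ae hp').2 ((Measure.ae_ae_comm (p := fun x w =>
    p ((MeasurableEquiv.piFinSuccAbove (fun _ => E) 0).symm (x, w))) hp').2 ?_)
  filter_upwards [h] with w hw
  filter_upwards [hw] with x hx
  simpa [MeasurableEquiv.piFinSuccAbove, Fin.consEquiv] using hx

variable {E F : Type*} [NormedAddCommGroup E] [NormedSpace ℝ E] [FiniteDimensional ℝ E]
  [MeasurableSpace E] [NormedAddCommGroup F] [NormedSpace ℝ F] [FiniteDimensional ℝ F]

theorem measurable_finrank_sup_span {ι : Type*} [Finite ι] [MeasurableSpace F] [BorelSpace F]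
    (V : Submodule ℝ F) :
    Measurable fun w : ι → F =>
      Module.finrank ℝ (V ⊔ Submodule.span ℝ (Set.range w) : Submodule ℝ F) := by
  obtain ⟨d, b, rfl⟩ := Submodule.fg_iff_exists_fin_generating_family.1 (IsNoetherian.noetherian V)
  have helim : Measurable fun w : ι → F => (Sum.elim b w : Fin d ⊕ ι → F) :=
    measurable_pi_lambda _ fun i => i.rec (fun _ => measurable_const) measurable_pi_apply
  convert measurable_finrank_span (𝕜 := ℝ).comp helim with w
  rw [Function.comp_apply, Set.Sum.elim_range, Submodule.span_union]

variable {μ : Measure E}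

theorem ae_finrank_sup_span_singleton (hμ : ∀ K : Submodule ℝ E, K ≠ ⊤ → μ K = 0)
    (T : E →ₗ[ℝ] F) (K : Submodule ℝ F) :
    ∀ᵐ x ∂μ, Module.finrank ℝ (K ⊔ Submodule.span ℝ {T x} : Submodule ℝ F) =
      min (Module.finrank ℝ K + 1) (Module.finrank ℝ (K ⊔ LinearMap.range T : Submodule ℝ F)) := by
  by_cases hle : LinearMap.range T ≤ K
  · refine Eventually.of_forall fun x => ?_
    rw [sup_eq_left.2 hle, sup_eq_left.2 (by simpa using hle ⟨x, rfl⟩),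
      min_eq_right (Nat.le_succ _)]
  · have hcomap : K.comap T ≠ ⊤ := fun htop => hle (LinearMap.range_le_iff_comap.2 htop)
    filter_upwards [measure_eq_zero_iff_ae_notMem.1 (hμ _ hcomap)] with x hx
    rw [min_eq_left (Submodule.finrank_lt_finrank_of_lt (left_lt_sup.2 hle))]
    exact Submodule.finrank_sup_span_singleton hx

theorem ae_finrank_sup_span_comp [BorelSpace E] [SigmaFinite μ]
    (hμ : ∀ K : Submodule ℝ E, K ≠ ⊤ → μ K = 0) (T : E →ₗ[ℝ] F) (V : Submodule ℝ F) (k : ℕ) :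
    ∀ᵐ v ∂(Measure.pi fun _ : Fin k => μ),
      Module.finrank ℝ (V ⊔ Submodule.span ℝ (Set.range (T ∘ v)) : Submodule ℝ F) =
        min (Module.finrank ℝ V + k)
          (Module.finrank ℝ (V ⊔ LinearMap.range T : Submodule ℝ F)) := by
  borelize F
  have hT : Measurable T := T.continuous_of_finiteDimensional.measurable
  induction k with
  | zero =>
    refine Eventually.of_forall fun v => ?_
    rw [Set.range_eq_empty, Submodule.span_empty, sup_bot_eq, add_zero,
      min_eq_left (Submodule.finrank_mono le_sup_left)]
  | succ k ih =>
    have hmeas : Measurable fun v : Fin (k + 1) → E =>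
        Module.finrank ℝ (V ⊔ Submodule.span ℝ (Set.range (T ∘ v)) : Submodule ℝ F) :=
      (measurable_finrank_sup_span V).comp (measurable_pi_lambda
        (fun v : Fin (k + 1) → E => T ∘ v) fun i => hT.comp (measurable_pi_apply i))
    refine ae_pi_cons (hmeas (measurableSet_singleton _)) ?_
    filter_upwards [ih] with w hw
    have hle : Submodule.span ℝ (Set.range (T ∘ w)) ≤ LinearMap.range T :=
      Submodule.span_le.2 (Set.range_comp_subset_range w T)
    filter_upwards [ae_finrank_sup_span_singleton hμ T (V ⊔ Submodule.span ℝ (Set.range (T ∘ w)))]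
      with x hx
    rw [sup_assoc, sup_assoc, sup_eq_right.2 hle, hw] at hx
    rw [Fin.comp_cons, Fin.range_cons, Submodule.span_insert, sup_comm (Submodule.span ℝ {T x}), hx]
    omega

theorem ae_finrank_sup_span [BorelSpace E] [SigmaFinite μ]
    (hμ : ∀ K : Submodule ℝ E, K ≠ ⊤ → μ K = 0) (V : Submodule ℝ E) (k : ℕ) :
    ∀ᵐ w ∂(Measure.pi fun _ : Fin k => μ),
      Module.finrank ℝ (V ⊔ Submodule.span ℝ (Set.range w) : Submodule ℝ E) =
        min (Module.finrank ℝ V + k) (Module.finrank ℝ E) := by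
  filter_upwards [ae_finrank_sup_span_comp hμ LinearMap.id V k] with w hw
  rwa [LinearMap.range_id, sup_top_eq, finrank_top] at hw

theorem ae_rank_mul {k : ℕ} {m n : Type*} [Fintype m] [Fintype n] (B : Matrix m n ℝ) :
    ∀ᵐ A : Fin k → m → ℝ, (Matrix.of A * B).rank = min k B.rank := by
  filter_upwards [ae_finrank_sup_span_comp (μ := (volume : Measure (m → ℝ)))
    (fun K hK => Measure.addHaar_submodule _ K hK) B.vecMulLinear ⊥ k] with A hA
  rw [bot_sup_eq, bot_sup_eq, finrank_bot, zero_add, range_vecMulLinear,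
    ← Matrix.rank_eq_finrank_span_row] at hA
  rw [Matrix.rank_eq_finrank_span_row, ← hA]
  rfl

end GenericPosition

section Independence

variable {Ω : Type*} [MeasurableSpace Ω] {P : Measure Ω} [IsFiniteMeasure P]

theorem ae_of_indepFun {α β : Type*} [MeasurableSpace α] [MeasurableSpace β] {X : Ω → α}
    {Y : Ω → β} (hX : AEMeasurable X P) (hY : AEMeasurable Y P) (hXY : IndepFun X Y P)
    {q : α → β → Prop} (hq : MeasurableSet {z : α × β | q z.1 z.2})
    (h : ∀ᵐ x ∂P.map X, ∀ᵐ y ∂P.map Y, q x y) : ∀ᵐ ω ∂P, q (X ω) (Y ω) := by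
  refine (ae_map_iff (hX.prodMk hY) hq).1 ?_
  rw [(indepFun_iff_map_prod_eq_prod_map_map hX hY).1 hXY]
  exact (Measure.ae_prod_iff_ae_ae hq).2 h

theorem ae_rank_mul_of_indepFun {k : ℕ} {m n : Type*} [Fintype m] [Fintype n]
    {Φ : Ω → Fin k → m → ℝ} (hΦ : AEMeasurable Φ P) (hΦac : P.map Φ ≪ volume)
    {B : Ω → m → n → ℝ} (hB : AEMeasurable B P) (hΦB : IndepFun Φ B P) :
    ∀ᵐ ω ∂P, (Matrix.of (Φ ω) * Matrix.of (B ω)).rank = min k (Matrix.of (B ω)).rank := by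
  have hmeas : MeasurableSet {z : (Fin k → m → ℝ) × (m → n → ℝ) |
      (Matrix.of z.1 * Matrix.of z.2).rank = min k (Matrix.of z.2).rank} :=
    measurableSet_eq_fun measurable_rank_mul
      (measurable_const.min (measurable_rank.comp measurable_snd))
  exact ae_of_indepFun (q := fun b A => (Matrix.of A * Matrix.of b).rank = min k (Matrix.of b).rank)
    hB hΦ hΦB.symm (measurable_swap hmeas)
    (Eventually.of_forall fun b => hΦac.ae_le (ae_rank_mul (Matrix.of b)))

theorem ae_rank_mul_mul_transpose {M : ℕ} {n : Type*} [Fintype n] [DecidableEq n]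
    {Φ : Ω → Fin M → n → ℝ} (hΦ : AEMeasurable Φ P) (hΦac : P.map Φ ≪ volume)
    {B : Ω → n → n → ℝ} (hB : AEMeasurable B P) (hΦB : IndepFun Φ B P)
    {S : Ω → Matrix n n ℝ} (hS : ∀ ω, (S ω).PosSemidef)
    (hSB : ∀ ω, LinearMap.range (S ω).toEuclideanLin =
      LinearMap.range (Matrix.of (B ω)).toEuclideanLin) :
    ∀ᵐ ω ∂P, (Matrix.of (Φ ω) * S ω * (Matrix.of (Φ ω)).transpose).rank =
      min M (S ω).rank := by
  filter_upwards [ae_rank_mul_of_indepFun hΦ hΦac hB hΦB] with ω hω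
  rw [← Matrix.conjTranspose_eq_transpose_of_trivial, rank_mul_mul_conjTranspose _ (hS ω),
    ← finrank_map_range_toEuclideanLin, hSB, finrank_map_range_toEuclideanLin, hω,
    ← finrank_range_toEuclideanLin, ← hSB, finrank_range_toEuclideanLin]

end Independence

section Gaussian

open scoped MatrixOrder

theorem pi_absolutelyContinuous_pi : ∀ {n : ℕ} {α : Fin n → Type*} [∀ i, MeasurableSpace (α i)]
    {μ ν : ∀ i, Measure (α i)} [∀ i, SigmaFinite (μ i)] [∀ i, SigmaFinite (ν i)],
    (∀ i, μ i ≪ ν i) → Measure.pi μ ≪ Measure.pi ν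
  | 0, _, _, μ, ν, _, _, _ => by
    rw [Measure.pi_of_empty μ, Measure.pi_of_empty ν]
  | n + 1, _, _, μ, ν, _, _, h => by
    rw [← (measurePreserving_piFinSuccAbove μ 0).symm.map_eq,
      ← (measurePreserving_piFinSuccAbove ν 0).symm.map_eq]
    exact ((h 0).prod (pi_absolutelyContinuous_pi fun i => h _)).map (MeasurableEquiv.measurable _)

theorem stdGaussian_absolutelyContinuous (E : Type*) [NormedAddCommGroup E]
    [InnerProductSpace ℝ E] [FiniteDimensional ℝ E] [MeasurableSpace E] [BorelSpace E] :
    stdGaussian E ≪ volume := by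
  let e := (stdOrthonormalBasis ℝ E).repr.symm
  rw [← stdGaussian_map e, ← e.measurePreserving.map_eq, ← map_pi_eq_stdGaussian,
    ← (PiLp.volume_preserving_toLp _).map_eq]
  exact ((pi_absolutelyContinuous_pi fun _ =>
    gaussianReal_absolutelyContinuous 0 one_ne_zero).map (by fun_prop)).map (by fun_prop)

theorem stdGaussian_submodule_eq_zero {E : Type*} [NormedAddCommGroup E]
    [InnerProductSpace ℝ E] [FiniteDimensional ℝ E] [MeasurableSpace E] [BorelSpace E]
    (K : Submodule ℝ E) (hK : K ≠ ⊤) : stdGaussian E K = 0 :=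
  stdGaussian_absolutelyContinuous E (Measure.addHaar_submodule _ K hK)

variable {ι : Type*} [Fintype ι] [DecidableEq ι]

theorem multivariateGaussian_zero_eq_map (S : Matrix ι ι ℝ) :
    multivariateGaussian 0 S =
      (stdGaussian (EuclideanSpace ℝ ι)).map (CFC.sqrt S).toEuclideanLin := by
  simp only [multivariateGaussian, zero_add]
  rfl

theorem multivariateGaussian_smul_one {s : ℝ} (hs : 0 ≤ s) :
    multivariateGaussian (0 : EuclideanSpace ℝ ι) (s • (1 : Matrix ι ι ℝ)) =
      (stdGaussian (EuclideanSpace ℝ ι)).map (√s • ·) := by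
  have hsqrt : CFC.sqrt (s • (1 : Matrix ι ι ℝ)) = √s • 1 := by
    refine CFC.sqrt_unique ?_ ?_
    · rw [smul_mul_smul_comm, Real.mul_self_sqrt hs, one_mul]
    · exact (Matrix.PosSemidef.one.smul (Real.sqrt_nonneg s)).nonneg
  rw [multivariateGaussian, hsqrt]
  simp

theorem multivariateGaussian_smul_one_absolutelyContinuous {s : ℝ} (hs : 0 < s) :
    multivariateGaussian (0 : EuclideanSpace ℝ ι) (s • (1 : Matrix ι ι ℝ)) ≪ volume := by
  rw [multivariateGaussian_smul_one hs.le]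
  refine ((stdGaussian_absolutelyContinuous _).map (by fun_prop)).trans ?_
  rw [Measure.map_addHaar_smul _ (Real.sqrt_pos.2 hs).ne']
  exact Measure.smul_absolutelyContinuous

theorem ae_mem_range_multivariateGaussian {S : Matrix ι ι ℝ} (hS : S.PosSemidef) :
    ∀ᵐ x ∂multivariateGaussian 0 S, x ∈ LinearMap.range S.toEuclideanLin := by
  rw [multivariateGaussian_zero_eq_map, ← range_toEuclideanLin_sqrt hS]
  refine (ae_map_iff (LinearMap.continuous_of_finiteDimensional _).aemeasurable
    (Submodule.closed_of_finiteDimensional (LinearMap.range _)).measurableSet).2 ?_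
  exact Eventually.of_forall fun x => LinearMap.mem_range_self _ x

theorem ae_notMem_multivariateGaussian {S : Matrix ι ι ℝ} (hS : S.PosSemidef)
    {K : Submodule ℝ (EuclideanSpace ℝ ι)} (hK : ¬ LinearMap.range S.toEuclideanLin ≤ K) :
    ∀ᵐ x ∂multivariateGaussian 0 S, x ∉ K := by
  have hcomap : K.comap (CFC.sqrt S).toEuclideanLin ≠ ⊤ := fun htop => hK <| by
    rwa [← range_toEuclideanLin_sqrt hS, LinearMap.range_le_iff_comap]
  rw [multivariateGaussian_zero_eq_map]
  exact (ae_map_iff (LinearMap.continuous_of_finiteDimensional _).aemeasurable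
    K.closed_of_finiteDimensional.measurableSet.compl).2
    (measure_eq_zero_iff_ae_notMem.1 (stdGaussian_submodule_eq_zero _ hcomap))

end Gaussian

section OrthogonalProjection

open scoped ComplexOrder

variable {𝕜 E ι : Type*} [RCLike 𝕜] [NormedAddCommGroup E] [InnerProductSpace 𝕜 E] [Fintype ι]
  [DecidableEq ι]

theorem starProjection_span_range {v : ι → E} (hv : LinearIndependent 𝕜 v)
    [(Submodule.span 𝕜 (Set.range v)).HasOrthogonalProjection] (x : E) :
    (Submodule.span 𝕜 (Set.range v)).starProjection x =
      ∑ k, ((Matrix.gram 𝕜 v)⁻¹.mulVec fun l => inner 𝕜 (v l) x) k • v k := by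
  set c := (Matrix.gram 𝕜 v)⁻¹.mulVec fun l => inner 𝕜 (v l) x with hc
  have hdet : IsUnit (Matrix.gram 𝕜 v).det :=
    (Matrix.det_gram_ne_zero_iff_linearIndependent.2 hv).isUnit
  have hgram : (Matrix.gram 𝕜 v).mulVec c = fun l => inner 𝕜 (v l) x := by
    rw [hc, Matrix.mulVec_mulVec, Matrix.mul_nonsing_inv _ hdet, Matrix.one_mulVec]
  have horth (l : ι) : inner 𝕜 (v l) (x - ∑ k, c k • v k) = 0 := by
    rw [inner_sub_right, ← congrFun hgram l, inner_sum, sub_eq_zero]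
    simp only [Matrix.mulVec, dotProduct, Matrix.gram_apply, inner_smul_right, mul_comm]
  refine Submodule.eq_starProjection_of_mem_orthogonal (Submodule.sum_mem _ fun k _ =>
    Submodule.smul_mem _ _ (Submodule.subset_span (Set.mem_range_self k))) ?_
  rw [← Submodule.span_singleton_le_iff_mem, ← Submodule.IsOrtho, Submodule.isOrtho_comm,
    Submodule.isOrtho_span]
  rintro _ ⟨l, rfl⟩ _ rfl
  exact horth l

theorem continuous_gram_inv :
    Continuous fun v : {v : ι → E // LinearIndependent 𝕜 v} => (Matrix.gram 𝕜 v.1)⁻¹ := by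
  have hcoe (i : ι) : Continuous fun v : {v : ι → E // LinearIndependent 𝕜 v} => v.1 i :=
    (continuous_apply i).comp continuous_subtype_val
  have hgram : Continuous fun v : {v : ι → E // LinearIndependent 𝕜 v} => Matrix.gram 𝕜 v.1 := by
    refine continuous_matrix fun i j => ?_
    simp only [Matrix.gram_apply]
    exact (hcoe i).inner (hcoe j)
  simp only [Matrix.inv_def, Ring.inverse_eq_inv']
  exact (hgram.matrix_det.inv₀ fun v =>
    Matrix.det_gram_ne_zero_iff_linearIndependent.2 v.2).smul hgram.matrix_adjugate

theorem continuous_starProjection_span_range {κ : Type*} [Finite κ] [FiniteDimensional 𝕜 E]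
    (x : E) :
    Continuous fun v : {v : κ → E // LinearIndependent 𝕜 v} =>
      (Submodule.span 𝕜 (Set.range v.1)).starProjection x := by
  classical
  have := Fintype.ofFinite κ
  have hcoe (i : κ) : Continuous fun v : {v : κ → E // LinearIndependent 𝕜 v} => v.1 i :=
    (continuous_apply i).comp continuous_subtype_val
  have hcoord : Continuous fun v : {v : κ → E // LinearIndependent 𝕜 v} =>
      (Matrix.gram 𝕜 v.1)⁻¹.mulVec fun l => inner 𝕜 (v.1 l) x :=
    continuous_gram_inv.matrix_mulVec (continuous_pi fun l => (hcoe l).inner continuous_const)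
  simp only [fun v : {v : κ → E // LinearIndependent 𝕜 v} => starProjection_span_range v.2 x]
  exact continuous_finsetSum _ fun k _ => ((continuous_apply k).comp hcoord).smul (hcoe k)

/-- The matrix of the orthogonal projection onto `K` in the standard basis; it turns a random
subspace into a random matrix with the same range. -/
noncomputable def projMatrix (K : Submodule 𝕜 (EuclideanSpace 𝕜 ι)) : Matrix ι ι 𝕜 :=
  Matrix.toEuclideanLin.symm K.starProjection.toLinearMap

theorem toEuclideanLin_projMatrix (K : Submodule 𝕜 (EuclideanSpace 𝕜 ι)) :
    (projMatrix K).toEuclideanLin = K.starProjection.toLinearMap :=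
  Matrix.toEuclideanLin.apply_symm_apply _

theorem range_projMatrix (K : Submodule 𝕜 (EuclideanSpace 𝕜 ι)) :
    LinearMap.range (projMatrix K).toEuclideanLin = K := by
  rw [toEuclideanLin_projMatrix]
  exact K.range_starProjection

theorem posSemidef_projMatrix (K : Submodule 𝕜 (EuclideanSpace 𝕜 ι)) :
    (projMatrix K).PosSemidef := by
  rw [← Matrix.isPositive_toEuclideanLin_iff, toEuclideanLin_projMatrix]
  exact (ContinuousLinearMap.isPositive_toLinearMap_iff _).2
    (ContinuousLinearMap.IsPositive.of_isStarProjection isStarProjection_starProjection)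

theorem projMatrix_apply (K : Submodule 𝕜 (EuclideanSpace 𝕜 ι)) (a b : ι) :
    projMatrix K a b = K.starProjection (EuclideanSpace.single b 1) a := by
  have h := congrArg (fun f => f (EuclideanSpace.single b 1) a) (toEuclideanLin_projMatrix K)
  simpa [Matrix.toLpLin_apply] using h

theorem range_projMatrix_add (K K' : Submodule 𝕜 (EuclideanSpace 𝕜 ι)) :
    LinearMap.range (projMatrix K + projMatrix K').toEuclideanLin = K ⊔ K' := by
  rw [range_toEuclideanLin_add (posSemidef_projMatrix K) (posSemidef_projMatrix K'),
    range_projMatrix, range_projMatrix]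

theorem rank_projMatrix_add (K K' : Submodule 𝕜 (EuclideanSpace 𝕜 ι)) :
    (projMatrix K + projMatrix K').rank = Module.finrank 𝕜 (K ⊔ K' : Submodule 𝕜 _) := by
  rw [← finrank_range_toEuclideanLin, range_projMatrix_add]

end OrthogonalProjection

section RandomSubspace

variable {N r r' : ℕ}

theorem Grassmann.measurable_projMatrix :
    Measurable fun V : Grassmann N r => Matrix.of.symm (projMatrix V.toSubmodule) := by
  refine measurable_pi_lambda _ fun a => measurable_pi_lambda _ fun b => Continuous.measurable ?_
  rw [continuous_coinduced_dom]
  simp only [Function.comp_def, Matrix.of_symm_apply, projMatrix_apply]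
  exact (EuclideanSpace.proj (𝕜 := ℝ) a).continuous.comp
    (continuous_starProjection_span_range (EuclideanSpace.single b (1 : ℝ)))

theorem Grassmann.measurable_projMatrix_add :
    Measurable fun q : Grassmann N r × Grassmann N r' =>
      Matrix.of.symm (projMatrix q.1.toSubmodule + projMatrix q.2.toSubmodule) :=
  (measurable_projMatrix.comp measurable_fst).add (measurable_projMatrix.comp measurable_snd)

theorem Grassmann.measurable_finrank_sup :
    Measurable fun q : Grassmann N r × Grassmann N r' =>
      Module.finrank ℝ (q.1.toSubmodule ⊔ q.2.toSubmodule : Submodule ℝ _) := by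
  simp only [← rank_projMatrix_add]
  exact measurable_rank.comp measurable_projMatrix_add

theorem Grassmann.ae_uniform {q : Grassmann N r → Prop} (hq : MeasurableSet {V | q V})
    (h : ∀ᵐ v ∂Measure.pi fun _ : Fin r => stdGaussian (EuclideanSpace ℝ (Fin N)),
      ∀ hv : LinearIndependent ℝ v, q (Frame.span ⟨v, hv⟩)) :
    ∀ᵐ V ∂uniform N r, q V := by
  have hspan : Measurable (Frame.span : Frame N r → Grassmann N r) :=
    continuous_coinduced_rng.measurable
  have hframe : MeasurableSet {v : Fin r → EuclideanSpace ℝ (Fin N) | LinearIndependent ℝ v} :=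
    isOpen_setOfPred_linearIndependent.measurableSet
  rw [uniform, ae_map_iff hspan.aemeasurable hq]
  refine (comap_subtype_coe_apply hframe _ _).trans (measure_mono_null ?_ (ae_iff.1 h))
  rintro _ ⟨v, hv, rfl⟩ hall
  exact hv (hall v.2)

theorem Grassmann.ae_uniform_finrank_sup (V : Grassmann N r) :
    ∀ᵐ W ∂uniform N r', Module.finrank ℝ (V.toSubmodule ⊔ W.toSubmodule : Submodule ℝ _) =
      min N (r + r') := by
  have hV : Module.finrank ℝ V.toSubmodule = r := V.2
  have hmeas : Measurable fun W : Grassmann N r' =>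
      Module.finrank ℝ (V.toSubmodule ⊔ W.toSubmodule : Submodule ℝ _) :=
    Measurable.of_uncurry_left (f := fun V W => Module.finrank ℝ
      (Grassmann.toSubmodule V ⊔ Grassmann.toSubmodule W : Submodule ℝ _)) measurable_finrank_sup
  refine ae_uniform (hmeas (measurableSet_singleton _)) ?_
  filter_upwards [ae_finrank_sup_span stdGaussian_submodule_eq_zero V.toSubmodule r'] with w hw _
  rw [hV, finrank_euclideanSpace_fin, min_comm] at hw
  exact hw

variable {Ω : Type*} [MeasurableSpace Ω] {P : Measure Ω} [IsFiniteMeasure P]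

theorem Grassmann.ae_finrank_sup_of_indepFun {V : Ω → Grassmann N r} {W : Ω → Grassmann N r'}
    (hV : AEMeasurable V P) (hW : AEMeasurable W P) (hVW : IndepFun V W P)
    (hWac : P.map W ≪ uniform N r') :
    ∀ᵐ ω ∂P, Module.finrank ℝ ((V ω).toSubmodule ⊔ (W ω).toSubmodule : Submodule ℝ _) =
      min N (r + r') := by
  have hmeas : MeasurableSet {q : Grassmann N r × Grassmann N r' |
      Module.finrank ℝ (q.1.toSubmodule ⊔ q.2.toSubmodule : Submodule ℝ _) = min N (r + r')} :=
    measurable_finrank_sup (measurableSet_singleton _)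
  exact ae_of_indepFun hV hW hVW hmeas
    (Eventually.of_forall fun K => hWac.ae_le (ae_uniform_finrank_sup K))

variable {M : ℕ} {Φ : Ω → Fin M → Fin N → ℝ} {V : Ω → Grassmann N r} {W : Ω → Grassmann N r'}
  {S T : Ω → Matrix (Fin N) (Fin N) ℝ}

theorem ae_rank_mul_mul_transpose_of_range_eq (hΦ : AEMeasurable Φ P)
    (hΦac : P.map Φ ≪ volume) (hV : AEMeasurable V P) (hΦV : IndepFun Φ V P)
    (hS : ∀ ω, (S ω).PosSemidef)
    (hSV : ∀ ω, (V ω).toSubmodule = LinearMap.range (S ω).toEuclideanLin) :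
    ∀ᵐ ω ∂P, (Matrix.of (Φ ω) * S ω * (Matrix.of (Φ ω)).transpose).rank = min M r := by
  have hmeas := Grassmann.measurable_projMatrix (N := N) (r := r)
  have hSr (ω : Ω) : (S ω).rank = r := by
    rw [← finrank_range_toEuclideanLin, ← hSV]
    exact (V ω).2
  simpa only [hSr] using ae_rank_mul_mul_transpose hΦ hΦac (hmeas.comp_aemeasurable hV)
    (hΦV.comp measurable_id hmeas) hS fun ω => (hSV ω).symm.trans (range_projMatrix _).symm

theorem ae_rank_mul_add_mul_transpose (hΦ : AEMeasurable Φ P) (hΦac : P.map Φ ≪ volume)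
    (hV : AEMeasurable V P) (hW : AEMeasurable W P) (hVW : IndepFun V W P)
    (hWac : P.map W ≪ Grassmann.uniform N r')
    (hΦVW : IndepFun Φ (fun ω => (V ω, W ω)) P)
    (hS : ∀ ω, (S ω).PosSemidef) (hT : ∀ ω, (T ω).PosSemidef)
    (hSV : ∀ ω, (V ω).toSubmodule = LinearMap.range (S ω).toEuclideanLin)
    (hTW : ∀ ω, (W ω).toSubmodule = LinearMap.range (T ω).toEuclideanLin) :
    ∀ᵐ ω ∂P, (Matrix.of (Φ ω) * (S ω + T ω) * (Matrix.of (Φ ω)).transpose).rank =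
      min M (min N (r + r')) := by
  have hmeas := Grassmann.measurable_projMatrix_add (N := N) (r := r) (r' := r')
  have hrange (ω : Ω) : LinearMap.range (S ω + T ω).toEuclideanLin =
      (V ω).toSubmodule ⊔ (W ω).toSubmodule := by
    rw [range_toEuclideanLin_add (hS ω) (hT ω), hSV, hTW]
  filter_upwards [Grassmann.ae_finrank_sup_of_indepFun hV hW hVW hWac,
    ae_rank_mul_mul_transpose hΦ hΦac (hmeas.comp_aemeasurable (hV.prodMk hW))
      (hΦVW.comp measurable_id hmeas) (fun ω => (hS ω).add (hT ω))
      fun ω => (hrange ω).trans (range_projMatrix_add _ _).symm] with ω hsup hrank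
  rw [hrank, ← finrank_range_toEuclideanLin, hrange, hsup]

end RandomSubspace

section LowNoiseLimit

variable {E : Type*} [NormedAddCommGroup E] [NormedSpace ℝ E]

-- The noise has size `√s`, negligible compared with the width `√√s` of the test regions.
theorem eventually_norm_sqrt_smul_lt (z : E) : ∀ᶠ s in 𝓝[>] (0 : ℝ), ‖√s • z‖ < √√s := by
  have hlim : Tendsto (fun s : ℝ => √√s * ‖z‖) (𝓝[>] 0) (𝓝 0) := by
    have hcont : Continuous fun s : ℝ => √√s * ‖z‖ := by fun_prop
    simpa using hcont.tendsto' 0 0 (by simp) |>.mono_left nhdsWithin_le_nhds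
  filter_upwards [hlim.eventually_lt_const one_pos, self_mem_nhdsWithin] with s hs hs0
  have hpos : 0 < √√s := Real.sqrt_pos.2 (Real.sqrt_pos.2 hs0)
  calc ‖√s • z‖ = √√s * (√√s * ‖z‖) := by
        rw [norm_smul, Real.norm_of_nonneg (Real.sqrt_nonneg s), ← mul_assoc,
          Real.mul_self_sqrt (Real.sqrt_nonneg s)]
    _ < √√s * 1 := mul_lt_mul_of_pos_left hs hpos
    _ = √√s := mul_one _

theorem eventually_add_smul_mem_thickening {U : Set E} {y : E} (hy : y ∈ U) (z : E) :
    ∀ᶠ s in 𝓝[>] (0 : ℝ), y + √s • z ∈ Metric.thickening (√√s) U := by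
  filter_upwards [eventually_norm_sqrt_smul_lt z] with s hs
  exact Metric.mem_thickening_iff.2 ⟨y, hy, by rwa [dist_self_add_left]⟩

theorem eventually_add_smul_notMem_thickening {U : Set E} (hU : IsClosed U) {y : E} (hy : y ∉ U)
    (z : E) : ∀ᶠ s in 𝓝[>] (0 : ℝ), y + √s • z ∉ Metric.thickening (√√s) U := by
  have hlim : Tendsto (fun s : ℝ => √√s + √√s) (𝓝[>] 0) (𝓝 0) := by
    have hcont : Continuous fun s : ℝ => √√s + √√s := by fun_prop
    exact (hcont.tendsto' 0 0 (by simp)).mono_left nhdsWithin_le_nhds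
  have hfar := hlim.eventually
    (Metric.eventually_notMem_thickening_of_infEDist_pos (hU.closure_eq.symm ▸ hy))
  filter_upwards [eventually_norm_sqrt_smul_lt z, hfar] with s hnoise hs hmem
  refine hs (Metric.thickening_thickening_subset _ _ _ ?_)
  exact Metric.mem_thickening_iff.2 ⟨_, hmem, by rwa [dist_self_add_right]⟩

end LowNoiseLimit

section Measurement

variable {M N : ℕ} (Φ : Matrix (Fin M) (Fin N) ℝ) (S : Matrix (Fin N) (Fin N) ℝ)

theorem continuous_measurement : Continuous fun q : EuclideanSpace ℝ (Fin N) ×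
    EuclideanSpace ℝ (Fin M) => Φ.toEuclideanLin q.1 + q.2 :=
  ((LinearMap.continuous_of_finiteDimensional _).comp continuous_fst).add continuous_snd

instance (s : ℝ) : IsProbabilityMeasure (measurementLaw Φ S s) :=
  Measure.isProbabilityMeasure_map (continuous_measurement Φ).aemeasurable

theorem measurementLaw_eq_map {s : ℝ} (hs : 0 ≤ s) :
    measurementLaw Φ S s =
      ((multivariateGaussian 0 S).prod (stdGaussian (EuclideanSpace ℝ (Fin M)))).map
        fun q => Φ.toEuclideanLin q.1 + √s • q.2 := by
  have hsmul : Measurable fun z : EuclideanSpace ℝ (Fin M) => √s • z := measurable_const_smul _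
  rw [measurementLaw, multivariateGaussian_smul_one hs]
  nth_rw 1 [← Measure.map_id (μ := multivariateGaussian 0 S)]
  rw [Measure.map_prod_map _ _ measurable_id hsmul,
    Measure.map_map (continuous_measurement Φ).measurable (measurable_id.prodMap hsmul)]
  rfl

theorem measurementLaw_absolutelyContinuous {s : ℝ} (hs : 0 < s) :
    measurementLaw Φ S s ≪ volume := by
  have hΦ : Measurable Φ.toEuclideanLin :=
    (LinearMap.continuous_of_finiteDimensional _).measurable
  have hconv : measurementLaw Φ S s = ((multivariateGaussian 0 S).map Φ.toEuclideanLin).conv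
      (multivariateGaussian 0 (s • (1 : Matrix (Fin M) (Fin M) ℝ))) := by
    rw [measurementLaw, Measure.conv]
    nth_rw 2 [← Measure.map_id (μ := multivariateGaussian 0 (s • (1 : Matrix (Fin M) (Fin M) ℝ)))]
    rw [Measure.map_prod_map _ _ hΦ measurable_id,
      Measure.map_map measurable_add (hΦ.prodMap measurable_id)]
    rfl
  rw [hconv]
  exact Measure.conv_absolutelyContinuous (multivariateGaussian_smul_one_absolutelyContinuous hs)

theorem tendsto_measurementLaw_zero {A : ℝ → Set (EuclideanSpace ℝ (Fin M))}
    (hA : ∀ s, MeasurableSet (A s))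
    (h : ∀ᵐ x ∂multivariateGaussian 0 S,
      ∀ z, ∀ᶠ s in 𝓝[>] (0 : ℝ), Φ.toEuclideanLin x + √s • z ∉ A s) :
    Tendsto (fun s => measurementLaw Φ S s (A s)) (𝓝[>] 0) (𝓝 0) := by
  have hmeas (s : ℝ) : Measurable fun q : EuclideanSpace ℝ (Fin N) × EuclideanSpace ℝ (Fin M) =>
      Φ.toEuclideanLin q.1 + √s • q.2 :=
    (continuous_measurement Φ).measurable.comp
      (measurable_fst.prodMk (measurable_snd.const_smul √s))
  have hlim := tendsto_measure_of_ae_tendsto_indicator_of_isFiniteMeasure (𝓝[>] (0 : ℝ))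
    (μ := (multivariateGaussian 0 S).prod (stdGaussian (EuclideanSpace ℝ (Fin M))))
    MeasurableSet.empty (fun s => hmeas s (hA s)) <| by
      filter_upwards [Measure.quasiMeasurePreserving_fst.ae h] with q hq
      filter_upwards [hq q.2] with s hs using iff_of_false hs (Set.notMem_empty q)
  rw [measure_empty] at hlim
  refine hlim.congr' ?_
  filter_upwards [self_mem_nhdsWithin] with s hs
  rw [measurementLaw_eq_map Φ S (le_of_lt hs), Measure.map_apply (hmeas s) (hA s)]

variable {S}

theorem tendsto_measurementLaw_compl_thickening (hS : S.PosSemidef) :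
    Tendsto (fun s => measurementLaw Φ S s (Metric.thickening (√√s)
      ((LinearMap.range S.toEuclideanLin).map Φ.toEuclideanLin))ᶜ) (𝓝[>] 0) (𝓝 0) := by
  refine tendsto_measurementLaw_zero Φ S
    (fun s => Metric.isOpen_thickening.measurableSet.compl) ?_
  filter_upwards [ae_mem_range_multivariateGaussian hS] with x hx z
  filter_upwards [eventually_add_smul_mem_thickening (U := Submodule.map Φ.toEuclideanLin _)
    (Submodule.mem_map_of_mem hx) z] with s hs using not_not.2 hs

theorem tendsto_measurementLaw_thickening (hS : S.PosSemidef)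
    {U : Submodule ℝ (EuclideanSpace ℝ (Fin M))}
    (hU : ¬ (LinearMap.range S.toEuclideanLin).map Φ.toEuclideanLin ≤ U) :
    Tendsto (fun s => measurementLaw Φ S s (Metric.thickening (√√s) U)) (𝓝[>] 0) (𝓝 0) := by
  rw [Submodule.map_le_iff_le_comap] at hU
  refine tendsto_measurementLaw_zero Φ S (fun s => Metric.isOpen_thickening.measurableSet) ?_
  filter_upwards [ae_notMem_multivariateGaussian hS hU] with x hx z
  exact eventually_add_smul_notMem_thickening U.closed_of_finiteDimensional hx z

end Measurement

section Classification

variable {L M N : ℕ} {p : Fin L → ℝ} {Φ : Matrix (Fin M) (Fin N) ℝ}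
  {S : Fin L → Matrix (Fin N) (Fin N) ℝ}

theorem setLIntegral_measurementPDF_mul {s : ℝ} (hs : 0 < s) (T : Matrix (Fin N) (Fin N) ℝ)
    (a : ℝ≥0∞) (A : Set (EuclideanSpace ℝ (Fin M))) :
    ∫⁻ y in A, measurementPDF Φ T s y * a = a * measurementLaw Φ T s A := by
  have hpdf : Measurable (measurementPDF Φ T s) := Measure.measurable_rnDeriv _ _
  rw [lintegral_mul_const _ hpdf, mul_comm]
  exact congrArg (a * ·)
    (Measure.setLIntegral_rnDeriv (measurementLaw_absolutelyContinuous Φ T hs) A)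

theorem IsMAPClassifier.mul_measurementLaw_inter_le {s : ℝ} (hs : 0 < s)
    {c : EuclideanSpace ℝ (Fin M) → Fin L} (hc : IsMAPClassifier p Φ S s c) (i j : Fin L)
    {A : Set (EuclideanSpace ℝ (Fin M))} (hA : MeasurableSet A) :
    ENNReal.ofReal (p i) * measurementLaw Φ (S i) s ({y | c y = j} ∩ A) ≤
      ENNReal.ofReal (p j) * measurementLaw Φ (S j) s ({y | c y = j} ∩ A) := by
  rw [← setLIntegral_measurementPDF_mul hs, ← setLIntegral_measurementPDF_mul hs]
  have hcj : MeasurableSet {y | c y = j} := hc.measurable (measurableSet_singleton j)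
  refine lintegral_mono_ae ?_
  filter_upwards [ae_restrict_mem (hcj.inter hA), ae_restrict_of_ae hc.isArgmax] with y hy hmax
  simpa only [show c y = j from hy.1] using hmax i

theorem IsMAPClassifier.mul_measurementLaw_le {s : ℝ} (hs : 0 < s)
    {c : EuclideanSpace ℝ (Fin M) → Fin L} (hc : IsMAPClassifier p Φ S s c) (i j : Fin L)
    {A : Set (EuclideanSpace ℝ (Fin M))} (hA : MeasurableSet A) :
    ENNReal.ofReal (p i) * measurementLaw Φ (S i) s {y | c y = j} ≤
      ENNReal.ofReal (p i) * measurementLaw Φ (S i) s Aᶜ +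
        ENNReal.ofReal (p j) * measurementLaw Φ (S j) s A := by
  calc ENNReal.ofReal (p i) * measurementLaw Φ (S i) s {y | c y = j}
      ≤ ENNReal.ofReal (p i) * measurementLaw Φ (S i) s ({y | c y = j} \ A) +
          ENNReal.ofReal (p i) * measurementLaw Φ (S i) s ({y | c y = j} ∩ A) := by
        rw [← mul_add, add_comm, measure_inter_add_sdiff _ hA]
    _ ≤ ENNReal.ofReal (p i) * measurementLaw Φ (S i) s ({y | c y = j} \ A) +
          ENNReal.ofReal (p j) * measurementLaw Φ (S j) s ({y | c y = j} ∩ A) := by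
        exact add_le_add le_rfl (hc.mul_measurementLaw_inter_le hs i j hA)
    _ ≤ ENNReal.ofReal (p i) * measurementLaw Φ (S i) s Aᶜ +
          ENNReal.ofReal (p j) * measurementLaw Φ (S j) s A := by
        gcongr
        exacts [fun y hy => hy.2, Set.inter_subset_right]

variable {c : ℝ → EuclideanSpace ℝ (Fin M) → Fin L}

theorem tendsto_mul_measurementLaw_eq (hS : ∀ i, (S i).PosSemidef)
    (hc : ∀ s, 0 < s → IsMAPClassifier p Φ S s (c s)) {i j : Fin L}
    (hij : ¬ (LinearMap.range (S j).toEuclideanLin).map Φ.toEuclideanLin ≤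
      (LinearMap.range (S i).toEuclideanLin).map Φ.toEuclideanLin) :
    Tendsto (fun s => ENNReal.ofReal (p i) * measurementLaw Φ (S i) s {y | c s y = j})
      (𝓝[>] 0) (𝓝 0) := by
  have hbound := (ENNReal.Tendsto.const_mul (a := ENNReal.ofReal (p i))
    (tendsto_measurementLaw_compl_thickening Φ (hS i)) (Or.inr ENNReal.ofReal_ne_top)).add
    (ENNReal.Tendsto.const_mul (a := ENNReal.ofReal (p j))
    (tendsto_measurementLaw_thickening Φ (hS j) hij) (Or.inr ENNReal.ofReal_ne_top))
  rw [mul_zero, mul_zero, add_zero] at hbound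
  refine tendsto_of_tendsto_of_tendsto_of_le_of_le' tendsto_const_nhds hbound
    (Eventually.of_forall fun _ => zero_le) ?_
  filter_upwards [self_mem_nhdsWithin] with s hs
  exact (hc s hs).mul_measurementLaw_le hs i j Metric.isOpen_thickening.measurableSet

theorem errorProb_le_sum (hp : ∀ i, 0 ≤ p i) (s : ℝ) (d : EuclideanSpace ℝ (Fin M) → Fin L) :
    errorProb p Φ S s d ≤ ∑ i, ∑ j ∈ Finset.univ.erase i,
      (ENNReal.ofReal (p i) * measurementLaw Φ (S i) s {y | d y = j}).toReal := by
  refine Finset.sum_le_sum fun i _ => ?_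
  have hcover : {y | d y ≠ i} ⊆ ⋃ j ∈ Finset.univ.erase i, {y | d y = j} := fun y hy => by
    simpa using hy
  calc p i * (measurementLaw Φ (S i) s).real {y | d y ≠ i}
      ≤ p i * ∑ j ∈ Finset.univ.erase i, (measurementLaw Φ (S i) s).real {y | d y = j} :=
        mul_le_mul_of_nonneg_left ((measureReal_mono hcover (measure_ne_top _ _)).trans
          (measureReal_biUnion_finset_le _ _)) (hp i)
    _ = ∑ j ∈ Finset.univ.erase i,
          (ENNReal.ofReal (p i) * measurementLaw Φ (S i) s {y | d y = j}).toReal := by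
        simp only [Finset.mul_sum, ENNReal.toReal_mul, ENNReal.toReal_ofReal (hp i), Measure.real]

theorem tendsto_errorProb (hp : ∀ i, 0 ≤ p i) (hS : ∀ i, (S i).PosSemidef)
    (hc : ∀ s, 0 < s → IsMAPClassifier p Φ S s (c s))
    (hΦS : ∀ i j, i ≠ j → ¬ (LinearMap.range (S j).toEuclideanLin).map Φ.toEuclideanLin ≤
      (LinearMap.range (S i).toEuclideanLin).map Φ.toEuclideanLin) :
    Tendsto (fun s => errorProb p Φ S s (c s)) (𝓝[>] 0) (𝓝 0) := by
  have hsum : Tendsto (fun s => ∑ i, ∑ j ∈ Finset.univ.erase i,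
      (ENNReal.ofReal (p i) * measurementLaw Φ (S i) s {y | c s y = j}).toReal)
      (𝓝[>] 0) (𝓝 (∑ i : Fin L, ∑ _j ∈ Finset.univ.erase i, 0)) :=
    tendsto_finsetSum _ fun i _ => tendsto_finsetSum _ fun j hj =>
      (ENNReal.tendsto_toReal ENNReal.zero_ne_top).comp
        (tendsto_mul_measurementLaw_eq hS hc (hΦS i j (Finset.ne_of_mem_erase hj).symm))
  simp only [Finset.sum_const_zero] at hsum
  exact squeeze_zero
    (fun s => Finset.sum_nonneg fun i _ => mul_nonneg (hp i) measureReal_nonneg)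
    (fun s => errorProb_le_sum hp s (c s)) hsum

theorem not_map_range_le_of_rank_lt {T T' : Matrix (Fin N) (Fin N) ℝ} (hT : T.PosSemidef)
    (hT' : T'.PosSemidef)
    (h : (Φ * T * Φ.transpose).rank < (Φ * (T + T') * Φ.transpose).rank) :
    ¬ (LinearMap.range T'.toEuclideanLin).map Φ.toEuclideanLin ≤
      (LinearMap.range T.toEuclideanLin).map Φ.toEuclideanLin := by
  intro hle
  rw [← Matrix.conjTranspose_eq_transpose_of_trivial, rank_mul_mul_conjTranspose _ hT,
    rank_mul_mul_conjTranspose _ (hT.add hT'), ← finrank_map_range_toEuclideanLin,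
    ← finrank_map_range_toEuclideanLin, range_toEuclideanLin_add hT hT', Submodule.map_sup,
    sup_eq_left.2 hle] at h
  exact h.false

end Classification

theorem Grassmann.HasDensity.absolutelyContinuous {N r : ℕ} {μ : Measure (Grassmann N r)}
    (hμ : HasDensity μ) : μ ≪ uniform N r := by
  obtain ⟨f, -, rfl⟩ := hμ
  exact withDensity_absolutelyContinuous _ f

theorem IsLeftRotationInvariant.absolutelyContinuous {M N : ℕ} {μ : Measure (Fin M → Fin N → ℝ)}
    (hμ : IsLeftRotationInvariant μ) : μ ≪ volume := by
  obtain ⟨f, -, rfl, -⟩ := hμ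
  exact withDensity_absolutelyContinuous _ f

end LowNoise

theorem proposition1_general {Ω : Type*} [MeasurableSpace Ω] (P : Measure Ω) [IsFiniteMeasure P]
    (L M N : ℕ) (r : Fin L → ℕ) (p : Fin L → ℝ) (hp : ∀ i, 0 ≤ p i)
    (S : Fin L → Ω → Matrix (Fin N) (Fin N) ℝ) (hS : ∀ i ω, (S i ω).PosSemidef)
    (R : ∀ i, Ω → LowNoise.Grassmann N (r i))
    (hR : ∀ i ω, (R i ω).toSubmodule = LinearMap.range (S i ω).toEuclideanLin)
    (hRmeas : ∀ i, AEMeasurable (R i) P) (hRindep : ∀ i j, i ≠ j → IndepFun (R i) (R j) P)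
    (hRac : ∀ i, P.map (R i) ≪ LowNoise.Grassmann.uniform N (r i))
    (Φ : Ω → Fin M → Fin N → ℝ) (hΦmeas : AEMeasurable Φ P) (hΦac : P.map Φ ≪ volume)
    (hΦindep : IndepFun Φ (fun ω i => R i ω) P) :
    (∀ᵐ ω ∂P,
      (∀ i, (Matrix.of (Φ ω) * S i ω * (Matrix.of (Φ ω)).transpose).rank = min M (r i)) ∧
      (∀ i j, i ≠ j →
        (Matrix.of (Φ ω) * (S i ω + S j ω) * (Matrix.of (Φ ω)).transpose).rank
          = min M (min N (r i + r j)))) ∧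
    ((∀ i, 0 < r i ∧ r i < min M N) →
      ∀ᵐ ω ∂P, ∀ c : ℝ → EuclideanSpace ℝ (Fin M) → Fin L,
        (∀ s, 0 < s →
          LowNoise.IsMAPClassifier p (Matrix.of (Φ ω)) (fun i => S i ω) s (c s)) →
        Tendsto
          (fun s => LowNoise.errorProb p (Matrix.of (Φ ω)) (fun i => S i ω) s (c s))
          (𝓝[>] 0) (𝓝 0)) := by
  have hrank : ∀ᵐ ω ∂P,
      (∀ i, (Matrix.of (Φ ω) * S i ω * (Matrix.of (Φ ω)).transpose).rank = min M (r i)) ∧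
      (∀ i j, i ≠ j →
        (Matrix.of (Φ ω) * (S i ω + S j ω) * (Matrix.of (Φ ω)).transpose).rank
          = min M (min N (r i + r j))) := by
    simp only [eventually_and, eventually_all]
    exact ⟨fun i => LowNoise.ae_rank_mul_mul_transpose_of_range_eq hΦmeas hΦac (hRmeas i)
        (hΦindep.comp measurable_id (measurable_pi_apply i)) (hS i) (hR i),
      fun i j hij => LowNoise.ae_rank_mul_add_mul_transpose hΦmeas hΦac (hRmeas i) (hRmeas j)
        (hRindep i j hij) (hRac j) (hΦindep.comp measurable_id
          ((measurable_pi_apply i).prodMk (measurable_pi_apply j))) (hS i) (hS j) (hR i) (hR j)⟩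
  refine ⟨hrank, fun hr => hrank.mono fun ω ⟨hone, htwo⟩ c hc => ?_⟩
  refine LowNoise.tendsto_errorProb hp (fun i => hS i ω) hc fun i j hij =>
    LowNoise.not_map_range_le_of_rank_lt (hS i ω) (hS j ω) ?_
  have hri := (hr i).2
  have hrj := (hr j).1
  rw [hone i, htwo i j hij]
  omega

theorem proposition1 {Ω : Type*} [MeasurableSpace Ω] (P : Measure Ω) [IsProbabilityMeasure P]
    (L M N r : ℕ) (hrN : r < N)
    -- the class probabilities
    (p : Fin L → ℝ) (hp0 : ∀ i, 0 ≤ p i) (hp1 : ∑ i, p i = 1)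
    -- the covariance matrices; their images are points of the Grassmann manifold
    (S : Fin L → Ω → Matrix (Fin N) (Fin N) ℝ) (hS : ∀ i ω, (S i ω).PosSemidef)
    (R : Fin L → Ω → LowNoise.Grassmann N r)
    (hR : ∀ i ω, (R i ω).toSubmodule = LinearMap.range (S i ω).toEuclideanLin)
    -- the images are independent random subspaces with a density
    (hRmeas : ∀ i, Measurable (R i)) (hRindep : iIndepFun R P)
    (hRdens : ∀ i, LowNoise.Grassmann.HasDensity (P.map (R i)))
    -- the random measurement matrix, independent of these subspaces
    (Φ : Ω → Fin M → Fin N → ℝ) (hΦmeas : Measurable Φ)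
    (hΦinv : LowNoise.IsLeftRotationInvariant (P.map Φ))
    (hΦindep : IndepFun Φ (fun ω i => R i ω) P) :
    (∀ᵐ ω ∂P,
      (∀ i, (Matrix.of (Φ ω) * S i ω * (Matrix.of (Φ ω)).transpose).rank = min M r) ∧
      (∀ i j, i ≠ j →
        (Matrix.of (Φ ω) * (S i ω + S j ω) * (Matrix.of (Φ ω)).transpose).rank
          = min M (min N (2 * r)))) ∧
    (0 < r → r + 1 ≤ M →
      ∀ᵐ ω ∂P, ∀ c : ℝ → EuclideanSpace ℝ (Fin M) → Fin L,
        (∀ s, 0 < s →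
          LowNoise.IsMAPClassifier p (Matrix.of (Φ ω)) (fun i => S i ω) s (c s)) →
        Tendsto
          (fun s => LowNoise.errorProb p (Matrix.of (Φ ω)) (fun i => S i ω) s (c s))
          (𝓝[>] 0) (𝓝 0)) := by
  obtain ⟨hrank, hlim⟩ := proposition1_general P L M N (fun _ => r) p hp0 S hS R hR
    (fun i => (hRmeas i).aemeasurable) (fun i j hij => hRindep.indepFun hij)
    (fun i => (hRdens i).absolutelyContinuous) Φ hΦmeas.aemeasurable hΦinv.absolutelyContinuous
    hΦindep
  exact ⟨by simpa only [two_mul] using hrank, fun hr hM => hlim fun _ => ⟨hr, lt_min hM hrN⟩⟩
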